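/- Fix a field $\Bbbk$ of characteristic $0$. Operads are symmetric, unital operads in (cohomologically) $\mathbb{Z}$-graded $\Bbbk$-vector spaces, with partial compositions $\circ_i$ and the Koszul sign rule; a dg operad is such an operad $\mathcal{P}$ with a degree $1$ operadic derivation $\partial$ satisfying $\partial^2=0$. An operadic derivation $D$ of degree $e$ along an operad morphism $f$ is a degree $e$ map of $\Sigma$-modules with $D(p\circ_i q)=D(p)\circ_i f(q)+(-1)^{e|p|}f(p)\circ_i D(q)$. Let $X$ be a graded $\Sigma$-module and $\mathrm{Fr}(X)$ the free operad on $X$. A quasi-free dg operad is one of the form $(\mathrm{Fr}(X),\partial)$, where $\partial$ is any degree $1$ derivation with $\partial^2=0$. It is called cofibrant if there is a grading $X=\bigoplus_{i\ge 0}X_{[i]}$ by graded sub-$\Sigma$-modules such that $\partial X_{[n]}\subseteq \mathrm{Fr}\big(\bigoplus_{i<n}X_{[i]}\big)$ for all $n\ge 0$. Let $\mathcal{R}=(\mathrm{Fr}(X),\partial_{\mathcal{R}})$ be a quasi-free dg operad and $k\in\mathbb{Z}$. Let $\Phi=\Bbbk\{\phi\}$ with $\phi$ of arity $1$ and degree $k$,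 and let $\underline{X}=\uparrow^{k-1}X$ be the suspension, $(\uparrow^{k-1}X)^d=X^{d-k+1}$, with $\underline{x}\in\underline{X}$ denoting the element corresponding to $x\in X$. Let $D_k\mathcal{R}=(\mathrm{Fr}(X\oplus\Phi\oplus\underline{X}),\partial)$, where $\partial$ is the degree $1$ derivation determined by $$\partial(x)=\partial_{\mathcal{R}}(x),\qquad \partial(\phi)=0,\qquad \partial(\underline{x})=\phi\circ_1 x-(-1)^{k|x|}\sum_{i=1}^{n}x\circ_i\phi-(-1)^k s(\partial_{\mathcal{R}}(x))$$ for $x\in X(n)$, and $s:\mathrm{Fr}(X)\to\mathrm{Fr}(X\oplus\Phi\oplus\underline{X})$ is the degree $k-1$ derivation along the inclusion determined by $s(x)=\underline{x}$ for $x\in X$. Proposition. If the quasi-free dg operad $\mathcal{R}=(\mathrm{Fr}(X),\partial_{\mathcal{R}})$ is cofibrant, then for every $k\in\mathbb{Z}$, $D_k\mathcal{R}$ is a quasi-free dg operad (in particular $\partial^2=0$) and it is cofibrant. -/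

import Mathlib

universe u v w

/-! ### Graded symmetric modules and graded symmetric operads over a field -/

/-- A graded `Σ`-module over `K`: for every arity `n` a `ℤ`-graded vector space (with
homogeneous components `V n d`, cohomological grading) with an action of `Σ_n` in every degree.
The action is written on the left; `p ↦ act σ⁻¹ p` is the corresponding right action. -/
structure SigmaModule (K : Type u) [Field K] where
  V : ℕ → ℤ → Type v
  [addCommGroup : ∀ n d, AddCommGroup (V n d)]
  [module : ∀ n d, Module K (V n d)]
  act : ∀ n d, Representation K (Equiv.Perm (Fin n)) (V n d)

attribute [instance] SigmaModule.addCommGroup SigmaModule.module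

/-- The inputs of a partial composition `p ∘ᵢ q`, with `p` of arity `m` and `q` of arity `n`
(`i` counted from `0`): the input `j ≠ i` of `p` becomes the input `j` if `j < i` and
`j + n - 1` if `j > i`; the input `l` of `q` becomes the input `i + l`. -/
def inputFun {m n r : ℕ} (h : m + n = r + 1) (i : Fin m) : {j : Fin m // j ≠ i} ⊕ Fin n → Fin r
  | Sum.inl j =>
      if hj : j.1 < i then ⟨j.1, by have := i.2; have := Fin.lt_def.1 hj; omega⟩
      else ⟨j.1 + n - 1, by
        have h1 := j.1.2
        have h2 : (j.1 : ℕ) ≠ i := fun e => j.2 (Fin.ext e)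
        have h3 : ¬ (j.1 : ℕ) < i := fun e => hj (Fin.lt_def.2 e)
        omega⟩
  | Sum.inr l => ⟨i + l, by have := i.2; have := l.2; omega⟩

theorem inputFun_bijective {m n r : ℕ} (h : m + n = r + 1) (i : Fin m) :
    Function.Bijective (inputFun h i) := by
  rw [Fintype.bijective_iff_injective_and_card]
  constructor
  · rintro (⟨j, hj⟩ | l) (⟨j', hj'⟩ | l') e
    · have h1 : (j : ℕ) ≠ i := fun e => hj (Fin.ext e)
      have h2 : (j' : ℕ) ≠ i := fun e => hj' (Fin.ext e)
      simp only [inputFun, Fin.lt_def] at e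
      congr 2
      split_ifs at e <;> simp only [Fin.mk.injEq] at e <;> ext <;> omega
    · have h1 : (j : ℕ) ≠ i := fun e => hj (Fin.ext e)
      have := l'.2
      simp only [inputFun, Fin.lt_def] at e
      split_ifs at e <;> simp only [Fin.mk.injEq] at e <;> omega
    · have h1 : (j' : ℕ) ≠ i := fun e => hj' (Fin.ext e)
      have := l.2
      simp only [inputFun, Fin.lt_def] at e
      split_ifs at e <;> simp only [Fin.mk.injEq] at e <;> omega
    · simp only [inputFun, Fin.mk.injEq] at e
      congr 1
      ext
      omega
  · have := i.2
    have e : Fintype.card {j : Fin m // j ≠ i} = m - 1 := by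
      simp [Fintype.card_subtype_compl]
    rw [Fintype.card_sum, e, Fintype.card_fin, Fintype.card_fin]
    omega

/-- `inputFun` as a bijection. -/
noncomputable def inputEquiv {m n r : ℕ} (h : m + n = r + 1) (i : Fin m) :
    {j : Fin m // j ≠ i} ⊕ Fin n ≃ Fin r :=
  Equiv.ofBijective (inputFun h i) (inputFun_bijective h i)

theorem inputEquiv_inl_val {m n r : ℕ} (h : m + n = r + 1) (i : Fin m)
    (j : {j : Fin m // j ≠ i}) :
    (inputEquiv h i (Sum.inl j)).1 = if j.1.1 < i.1 then j.1.1 else j.1.1 + n - 1 := by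
  simp only [inputEquiv, Equiv.ofBijective_apply, inputFun, Fin.lt_def]
  split_ifs <;> rfl

theorem inputEquiv_inr_val {m n r : ℕ} (h : m + n = r + 1) (i : Fin m) (l : Fin n) :
    (inputEquiv h i (Sum.inr l)).1 = i.1 + l.1 := rfl

/-- The permutation `σ ∘ᵢ τ` of the inputs of `p ∘ᵢ q` which permutes the inputs of `p`
by `σ` and those of `q` by `τ`. -/
noncomputable def blockPerm {m n r : ℕ} (h : m + n = r + 1) (i : Fin m)
    (σ : Equiv.Perm (Fin m)) (τ : Equiv.Perm (Fin n)) : Equiv.Perm (Fin r) :=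
  ((inputEquiv h i).symm.trans
    (Equiv.sumCongr
      (σ.subtypeEquiv (p := fun j => j ≠ i) (q := fun j => j ≠ σ i) (by simp)) τ)).trans
    (inputEquiv h (σ i))

theorem blockPerm_inl {m n r : ℕ} (h : m + n = r + 1) (i : Fin m) (σ : Equiv.Perm (Fin m))
    (τ : Equiv.Perm (Fin n)) (j : Fin m) (hj : j ≠ i) :
    blockPerm h i σ τ (inputEquiv h i (Sum.inl ⟨j, hj⟩)) =
      inputEquiv h (σ i) (Sum.inl ⟨σ j, fun e => hj (σ.injective e)⟩) := by
  simp only [blockPerm, Equiv.trans_apply, Equiv.symm_apply_apply]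
  rfl

theorem blockPerm_inr {m n r : ℕ} (h : m + n = r + 1) (i : Fin m) (σ : Equiv.Perm (Fin m))
    (τ : Equiv.Perm (Fin n)) (l : Fin n) :
    blockPerm h i σ τ (inputEquiv h i (Sum.inr l)) = inputEquiv h (σ i) (Sum.inr (τ l)) := by
  simp only [blockPerm, Equiv.trans_apply, Equiv.symm_apply_apply]
  rfl

theorem blockPerm_unary_right {m : ℕ} (h : m + 1 = m + 1) (i : Fin m)
    (σ : Equiv.Perm (Fin m)) : blockPerm h i σ (1 : Equiv.Perm (Fin 1)) = σ := by
  have key : ∀ (i j : Fin m) (hj : j ≠ i), inputEquiv h i (Sum.inl ⟨j, hj⟩) = j := by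
    intro i j hj
    simp only [inputEquiv, Equiv.ofBijective_apply, inputFun]
    split_ifs <;> simp
  have key2 : ∀ (i : Fin m) (l : Fin 1), inputEquiv h i (Sum.inr l) = i := by
    intro i l
    ext
    simp [inputEquiv, inputFun]
  apply Equiv.ext
  intro x
  obtain ⟨y, rfl⟩ := (inputEquiv h i).surjective x
  rcases y with ⟨j, hj⟩ | l
  · rw [blockPerm_inl, key, key]
  · rw [blockPerm_inr, key2, key2]

theorem blockPerm_unary_left {n : ℕ} (h : 1 + n = n + 1) (τ : Equiv.Perm (Fin n)) :
    blockPerm h 0 1 τ = τ := by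
  have key2 : ∀ (i : Fin 1) (l : Fin n), inputEquiv h i (Sum.inr l) = l := by
    intro i l
    ext
    have := i.2
    simp [inputEquiv, inputFun]
  apply Equiv.ext
  intro x
  obtain ⟨y, rfl⟩ := (inputEquiv h 0).surjective x
  rcases y with ⟨j, hj⟩ | l
  · exact absurd (Subsingleton.elim _ _) hj
  · rw [blockPerm_inr, key2, key2]

/-- A (unital, symmetric) operad in graded `K`-vector spaces, given by partial compositions
`p ∘ᵢ q = comp _ _ i p q` (with `i` counted from `0`), with the Koszul sign rule.
Arities and degrees of a composite are recorded by equations, so that no transport along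
equalities is needed. -/
structure GradedOperad (K : Type u) [Field K] extends SigmaModule.{u, v} K where
  one : V 1 0
  comp : ∀ {m n r : ℕ} {a b c : ℤ}, m + n = r + 1 → a + b = c → Fin m →
    (V m a →ₗ[K] V n b →ₗ[K] V r c)
  one_comp : ∀ {n : ℕ} {a : ℤ} (h : 1 + n = n + 1) (hd : 0 + a = a) (p : V n a),
    comp h hd 0 one p = p
  comp_one : ∀ {n : ℕ} {a : ℤ} (h : n + 1 = n + 1) (hd : a + 0 = a) (i : Fin n) (p : V n a),
    comp h hd i p one = p
  comp_act : ∀ {m n r : ℕ} {a b c : ℤ} (h : m + n = r + 1) (hd : a + b = c) (i : Fin m)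
    (σ : Equiv.Perm (Fin m)) (τ : Equiv.Perm (Fin n)) (p : V m a) (q : V n b),
    comp h hd (σ i) (act m a σ p) (act n b τ q) = act r c (blockPerm h i σ τ) (comp h hd i p q)
  /-- `(p ∘ᵢ q) ∘ t = p ∘ᵢ (q ∘ⱼ t)`, with `t` inserted into the input `j` of `q`. -/
  comp_assoc : ∀ {m n l s t r : ℕ} {a b c d e f : ℤ} (h₁ : m + n = s + 1) (h₂ : s + l = r + 1)
    (h₃ : n + l = t + 1) (h₄ : m + t = r + 1) (d₁ : a + b = d) (d₂ : d + c = f)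
    (d₃ : b + c = e) (d₄ : a + e = f) (i : Fin m) (j : Fin n)
    (p : V m a) (q : V n b) (t : V l c),
    comp h₂ d₂ (inputEquiv h₁ i (Sum.inr j)) (comp h₁ d₁ i p q) t =
      comp h₄ d₄ i p (comp h₃ d₃ j q t)
  /-- `(p ∘ᵢ q) ∘ t = (-1)^{|q||t|} (p ∘ⱼ t) ∘ q`, with `q`, `t` inserted into the distinct
  inputs `i`, `j` of `p`. -/
  comp_comm : ∀ {m n l s t r : ℕ} {a b c d e f : ℤ} (h₁ : m + n = s + 1) (h₂ : s + l = r + 1)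
    (h₃ : m + l = t + 1) (h₄ : t + n = r + 1) (d₁ : a + b = d) (d₂ : d + c = f)
    (d₃ : a + c = e) (d₄ : e + b = f) (i j : Fin m) (hji : j ≠ i) (hij : i ≠ j)
    (p : V m a) (q : V n b) (t : V l c),
    comp h₂ d₂ (inputEquiv h₁ i (Sum.inl ⟨j, hji⟩)) (comp h₁ d₁ i p q) t =
      (b * c).negOnePow •
        comp h₄ d₄ (inputEquiv h₃ j (Sum.inl ⟨i, hij⟩)) (comp h₃ d₃ j p t) q

namespace GradedOperad

variable {K : Type u} [Field K]

/-- Morphisms of graded operads (of degree `0`). -/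
structure Hom (P : GradedOperad.{u, v} K) (Q : GradedOperad.{u, w} K) where
  map : ∀ {n : ℕ} {d : ℤ}, P.V n d →ₗ[K] Q.V n d
  map_one : map P.one = Q.one
  map_act : ∀ {n : ℕ} {d : ℤ} (σ : Equiv.Perm (Fin n)) (p : P.V n d),
    map (P.act n d σ p) = Q.act n d σ (map p)
  map_comp : ∀ {m n r : ℕ} {a b c : ℤ} (h : m + n = r + 1) (hd : a + b = c) (i : Fin m)
    (p : P.V m a) (q : P.V n b), map (P.comp h hd i p q) = Q.comp h hd i (map p) (map q)

/-- The identity morphism. -/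
def Hom.id (P : GradedOperad.{u, v} K) : Hom P P where
  map := LinearMap.id
  map_one := rfl
  map_act _ _ := rfl
  map_comp _ _ _ _ _ := rfl

/-- Operadic derivations `D : P → Q` of degree `e` along a morphism `f : P → Q`: maps of
`Σ`-modules of degree `e` such that `D(p ∘ᵢ q) = D(p) ∘ᵢ f(q) + (-1)^{e|p|} f(p) ∘ᵢ D(q)`. -/
structure Derivation {P : GradedOperad.{u, v} K} {Q : GradedOperad.{u, w} K} (f : Hom P Q)
    (e : ℤ) where
  map : ∀ {n : ℕ} {a b : ℤ}, a + e = b → (P.V n a →ₗ[K] Q.V n b)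
  map_act : ∀ {n : ℕ} {a b : ℤ} (h : a + e = b) (σ : Equiv.Perm (Fin n)) (p : P.V n a),
    map h (P.act n a σ p) = Q.act n b σ (map h p)
  leibniz : ∀ {m n r : ℕ} {a b c a' b' c' : ℤ} (h : m + n = r + 1) (hd : a + b = c)
    (ha : a + e = a') (hb : b + e = b') (hc : c + e = c') (hl : a' + b = c') (hr : a + b' = c')
    (i : Fin m) (p : P.V m a) (q : P.V n b),
    map hc (P.comp h hd i p q) =
      Q.comp h hl i (map ha p) (f.map q) +
        (e * a).negOnePow • Q.comp h hr i (f.map p) (map hb q)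

/-- Membership in the suboperad generated by a family `G` of sets of homogeneous elements. -/
inductive Generated (P : GradedOperad.{u, v} K) (G : ∀ n d, Set (P.V n d)) :
    ∀ {n : ℕ} {d : ℤ}, P.V n d → Prop
  | of {n : ℕ} {d : ℤ} (p : P.V n d) (hp : p ∈ G n d) : Generated P G p
  | one : Generated P G P.one
  | zero {n : ℕ} {d : ℤ} : Generated P G (0 : P.V n d)
  | add {n : ℕ} {d : ℤ} {p q : P.V n d} (hp : Generated P G p) (hq : Generated P G q) :
      Generated P G (p + q)
  | smul {n : ℕ} {d : ℤ} (c : K) {p : P.V n d} (hp : Generated P G p) : Generated P G (c • p)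
  | act {n : ℕ} {d : ℤ} (σ : Equiv.Perm (Fin n)) {p : P.V n d} (hp : Generated P G p) :
      Generated P G (P.act n d σ p)
  | comp {m n r : ℕ} {a b c : ℤ} (h : m + n = r + 1) (hd : a + b = c) (i : Fin m)
      {p : P.V m a} {q : P.V n b} (hp : Generated P G p) (hq : Generated P G q) :
      Generated P G (P.comp h hd i p q)

end GradedOperad

/-! ### The free graded operad on a graded `Σ`-module

It is constructed as the quotient of formal operadic expressions in elements of `X` by the
congruence generated by the axioms of a graded operad, and the relations saying that
`X → Fr(X)` is a morphism of graded `Σ`-modules. -/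

namespace FreeOperad

variable {K : Type u} [Field K]

/-- Formal operadic expressions in homogeneous elements of `X`. -/
inductive Term (X : SigmaModule.{u, v} K) : ℕ → ℤ → Type (max u v)
  | gen {n : ℕ} {d : ℤ} (x : X.V n d) : Term X n d
  | one : Term X 1 0
  | zero {n : ℕ} {d : ℤ} : Term X n d
  | add {n : ℕ} {d : ℤ} (p q : Term X n d) : Term X n d
  | smul {n : ℕ} {d : ℤ} (c : K) (p : Term X n d) : Term X n d
  | act {n : ℕ} {d : ℤ} (σ : Equiv.Perm (Fin n)) (p : Term X n d) : Term X n d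
  | comp {m n r : ℕ} {a b c : ℤ} (h : m + n = r + 1) (hd : a + b = c) (i : Fin m)
      (p : Term X m a) (q : Term X n b) : Term X r c

/-- The congruence defining the free operad. -/
inductive Rel (X : SigmaModule.{u, v} K) : ∀ {n : ℕ} {d : ℤ}, Term X n d → Term X n d → Prop
  -- it is a congruence
  | refl {n : ℕ} {d : ℤ} (p : Term X n d) : Rel X p p
  | symm {n : ℕ} {d : ℤ} {p q : Term X n d} (h : Rel X p q) : Rel X q p
  | trans {n : ℕ} {d : ℤ} {p q t : Term X n d} (h : Rel X p q) (h' : Rel X q t) : Rel X p t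
  | add_congr {n : ℕ} {d : ℤ} {p p' q q' : Term X n d} (hp : Rel X p p') (hq : Rel X q q') :
      Rel X (.add p q) (.add p' q')
  | smul_congr {n : ℕ} {d : ℤ} (c : K) {p p' : Term X n d} (hp : Rel X p p') :
      Rel X (.smul c p) (.smul c p')
  | act_congr {n : ℕ} {d : ℤ} (σ : Equiv.Perm (Fin n)) {p p' : Term X n d} (hp : Rel X p p') :
      Rel X (.act σ p) (.act σ p')
  | comp_congr {m n r : ℕ} {a b c : ℤ} (h : m + n = r + 1) (hd : a + b = c) (i : Fin m)
      {p p' : Term X m a} {q q' : Term X n b} (hp : Rel X p p') (hq : Rel X q q') :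
      Rel X (.comp h hd i p q) (.comp h hd i p' q')
  -- axioms of a vector space
  | add_comm {n : ℕ} {d : ℤ} (p q : Term X n d) : Rel X (.add p q) (.add q p)
  | add_assoc {n : ℕ} {d : ℤ} (p q t : Term X n d) :
      Rel X (.add (.add p q) t) (.add p (.add q t))
  | zero_add {n : ℕ} {d : ℤ} (p : Term X n d) : Rel X (.add .zero p) p
  | zero_smul {n : ℕ} {d : ℤ} (p : Term X n d) : Rel X (.smul 0 p) .zero
  | one_smul {n : ℕ} {d : ℤ} (p : Term X n d) : Rel X (.smul 1 p) p
  | mul_smul {n : ℕ} {d : ℤ} (c c' : K) (p : Term X n d) :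
      Rel X (.smul (c * c') p) (.smul c (.smul c' p))
  | add_smul {n : ℕ} {d : ℤ} (c c' : K) (p : Term X n d) :
      Rel X (.smul (c + c') p) (.add (.smul c p) (.smul c' p))
  | smul_add {n : ℕ} {d : ℤ} (c : K) (p q : Term X n d) :
      Rel X (.smul c (.add p q)) (.add (.smul c p) (.smul c q))
  -- `X → Fr(X)` is a morphism of graded `Σ`-modules
  | gen_add {n : ℕ} {d : ℤ} (x y : X.V n d) : Rel X (.gen (x + y)) (.add (.gen x) (.gen y))
  | gen_smul {n : ℕ} {d : ℤ} (c : K) (x : X.V n d) : Rel X (.gen (c • x)) (.smul c (.gen x))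
  | gen_act {n : ℕ} {d : ℤ} (σ : Equiv.Perm (Fin n)) (x : X.V n d) :
      Rel X (.gen (X.act n d σ x)) (.act σ (.gen x))
  -- the symmetric groups act linearly
  | act_add {n : ℕ} {d : ℤ} (σ : Equiv.Perm (Fin n)) (p q : Term X n d) :
      Rel X (.act σ (.add p q)) (.add (.act σ p) (.act σ q))
  | act_smul {n : ℕ} {d : ℤ} (σ : Equiv.Perm (Fin n)) (c : K) (p : Term X n d) :
      Rel X (.act σ (.smul c p)) (.smul c (.act σ p))
  | one_act {n : ℕ} {d : ℤ} (p : Term X n d) : Rel X (.act 1 p) p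
  | mul_act {n : ℕ} {d : ℤ} (σ τ : Equiv.Perm (Fin n)) (p : Term X n d) :
      Rel X (.act (σ * τ) p) (.act σ (.act τ p))
  -- the partial compositions are bilinear
  | add_comp {m n r : ℕ} {a b c : ℤ} (h : m + n = r + 1) (hd : a + b = c) (i : Fin m)
      (p p' : Term X m a) (q : Term X n b) :
      Rel X (.comp h hd i (.add p p') q) (.add (.comp h hd i p q) (.comp h hd i p' q))
  | smul_comp {m n r : ℕ} {a b c : ℤ} (h : m + n = r + 1) (hd : a + b = c) (i : Fin m)
      (k : K) (p : Term X m a) (q : Term X n b) :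
      Rel X (.comp h hd i (.smul k p) q) (.smul k (.comp h hd i p q))
  | comp_add {m n r : ℕ} {a b c : ℤ} (h : m + n = r + 1) (hd : a + b = c) (i : Fin m)
      (p : Term X m a) (q q' : Term X n b) :
      Rel X (.comp h hd i p (.add q q')) (.add (.comp h hd i p q) (.comp h hd i p q'))
  | comp_smul {m n r : ℕ} {a b c : ℤ} (h : m + n = r + 1) (hd : a + b = c) (i : Fin m)
      (k : K) (p : Term X m a) (q : Term X n b) :
      Rel X (.comp h hd i p (.smul k q)) (.smul k (.comp h hd i p q))
  -- axioms of a graded operad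
  | one_comp {n : ℕ} {a : ℤ} (h : 1 + n = n + 1) (hd : 0 + a = a) (p : Term X n a) :
      Rel X (.comp h hd 0 .one p) p
  | comp_one {n : ℕ} {a : ℤ} (h : n + 1 = n + 1) (hd : a + 0 = a) (i : Fin n)
      (p : Term X n a) : Rel X (.comp h hd i p .one) p
  | comp_act {m n r : ℕ} {a b c : ℤ} (h : m + n = r + 1) (hd : a + b = c) (i : Fin m)
      (σ : Equiv.Perm (Fin m)) (τ : Equiv.Perm (Fin n)) (p : Term X m a) (q : Term X n b) :
      Rel X (.comp h hd (σ i) (.act σ p) (.act τ q))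
        (.act (blockPerm h i σ τ) (.comp h hd i p q))
  | comp_assoc {m n l s t r : ℕ} {a b c d e f : ℤ} (h₁ : m + n = s + 1)
      (h₂ : s + l = r + 1) (h₃ : n + l = t + 1) (h₄ : m + t = r + 1) (d₁ : a + b = d)
      (d₂ : d + c = f) (d₃ : b + c = e) (d₄ : a + e = f) (i : Fin m) (j : Fin n)
      (p : Term X m a) (q : Term X n b) (t : Term X l c) :
      Rel X (.comp h₂ d₂ (inputEquiv h₁ i (Sum.inr j)) (.comp h₁ d₁ i p q) t)
        (.comp h₄ d₄ i p (.comp h₃ d₃ j q t))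
  | comp_comm {m n l s t r : ℕ} {a b c d e f : ℤ} (h₁ : m + n = s + 1)
      (h₂ : s + l = r + 1) (h₃ : m + l = t + 1) (h₄ : t + n = r + 1) (d₁ : a + b = d)
      (d₂ : d + c = f) (d₃ : a + c = e) (d₄ : e + b = f) (i j : Fin m) (hji : j ≠ i)
      (hij : i ≠ j) (p : Term X m a) (q : Term X n b) (t : Term X l c) :
      Rel X (.comp h₂ d₂ (inputEquiv h₁ i (Sum.inl ⟨j, hji⟩)) (.comp h₁ d₁ i p q) t)
        (.smul (((b * c).negOnePow : ℤ) : K)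
          (.comp h₄ d₄ (inputEquiv h₃ j (Sum.inl ⟨i, hij⟩)) (.comp h₃ d₃ j p t) q))

/-- The homogeneous components of the free operad. -/
def Carrier (X : SigmaModule.{u, v} K) (n : ℕ) (d : ℤ) : Type (max u v) :=
  Quot (Rel X (n := n) (d := d))

variable {X : SigmaModule.{u, v} K}

/-- The class of a formal expression. -/
def mk {n : ℕ} {d : ℤ} (p : Term X n d) : Carrier X n d := Quot.mk _ p

theorem mk_eq {n : ℕ} {d : ℤ} {p q : Term X n d} (h : Rel X p q) : mk p = mk q :=
  Quot.sound h

theorem mk_surjective {n : ℕ} {d : ℤ} (p : Carrier X n d) : ∃ t : Term X n d, mk t = p :=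
  Quot.exists_rep p

instance (n : ℕ) (d : ℤ) : Zero (Carrier X n d) := ⟨mk .zero⟩

instance (n : ℕ) (d : ℤ) : Add (Carrier X n d) :=
  ⟨Quot.map₂ Term.add (fun p _ _ h => .add_congr (.refl p) h)
    (fun _ _ q h => .add_congr h (.refl q))⟩

instance (n : ℕ) (d : ℤ) : SMul K (Carrier X n d) :=
  ⟨fun c => Quot.map (Term.smul c) (fun _ _ h => .smul_congr c h)⟩

instance (n : ℕ) (d : ℤ) : Neg (Carrier X n d) := ⟨fun p => (-1 : K) • p⟩

theorem mk_add {n : ℕ} {d : ℤ} (p q : Term X n d) : mk (.add p q) = mk p + mk q := rfl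

theorem mk_smul {n : ℕ} {d : ℤ} (c : K) (p : Term X n d) : mk (.smul c p) = c • mk p := rfl

theorem mk_zero {n : ℕ} {d : ℤ} : mk (.zero : Term X n d) = 0 := rfl

instance (n : ℕ) (d : ℤ) : AddCommGroup (Carrier X n d) where
  add_assoc := by rintro ⟨p⟩ ⟨q⟩ ⟨t⟩; exact mk_eq (.add_assoc p q t)
  zero_add := by rintro ⟨p⟩; exact mk_eq (.zero_add p)
  add_zero := by rintro ⟨p⟩; exact mk_eq (.trans (.add_comm _ _) (.zero_add p))
  add_comm := by rintro ⟨p⟩ ⟨q⟩; exact mk_eq (.add_comm p q)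
  nsmul := nsmulRec
  zsmul := zsmulRec
  neg_add_cancel := by
    rintro ⟨p⟩
    change mk (.add (.smul (-1) p) p) = mk .zero
    have h : mk (.smul ((-1 : K) + 1) p) = mk .zero := by
      rw [neg_add_cancel]; exact mk_eq (.zero_smul p)
    rw [← h]
    exact mk_eq (.symm (.trans (.add_smul _ _ _)
      (.add_congr (.refl _) (.one_smul p))))

instance (n : ℕ) (d : ℤ) : Module K (Carrier X n d) where
  one_smul := by rintro ⟨p⟩; exact mk_eq (.one_smul p)
  mul_smul := by rintro c c' ⟨p⟩; exact mk_eq (.mul_smul c c' p)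
  add_smul := by rintro c c' ⟨p⟩; exact mk_eq (.add_smul c c' p)
  smul_add := by rintro c ⟨p⟩ ⟨q⟩; exact mk_eq (.smul_add c p q)
  zero_smul := by rintro ⟨p⟩; exact mk_eq (.zero_smul p)
  smul_zero := by
    intro c
    change mk (.smul c .zero) = mk .zero
    refine (mk_eq (.smul_congr c (.symm (.zero_smul .zero)))).trans ?_
    refine (mk_eq (.symm (.mul_smul c 0 .zero))).trans ?_
    rw [mul_zero]
    exact mk_eq (.zero_smul .zero)

/-- The action of the symmetric groups on the free operad. -/
def actRep (X : SigmaModule.{u, v} K) (n : ℕ) (d : ℤ) :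
    Representation K (Equiv.Perm (Fin n)) (Carrier X n d) where
  toFun σ :=
    { toFun := Quot.map (Term.act σ) (fun _ _ h => .act_congr σ h)
      map_add' := by rintro ⟨p⟩ ⟨q⟩; exact mk_eq (.act_add σ p q)
      map_smul' := by rintro c ⟨p⟩; exact mk_eq (.act_smul σ c p) }
  map_one' := by ext ⟨p⟩; exact mk_eq (.one_act p)
  map_mul' σ τ := by ext ⟨p⟩; exact mk_eq (.mul_act σ τ p)

/-- Partial compositions of the free operad. -/
def compMap (X : SigmaModule.{u, v} K) {m n r : ℕ} {a b c : ℤ} (h : m + n = r + 1)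
    (hd : a + b = c) (i : Fin m) :
    Carrier X m a →ₗ[K] Carrier X n b →ₗ[K] Carrier X r c :=
  LinearMap.mk₂ K
    (Quot.map₂ (Term.comp h hd i) (fun p _ _ hq => .comp_congr h hd i (.refl p) hq)
      (fun _ _ q hp => .comp_congr h hd i hp (.refl q)))
    (by rintro ⟨p⟩ ⟨p'⟩ ⟨q⟩; exact mk_eq (.add_comp h hd i p p' q))
    (by rintro k ⟨p⟩ ⟨q⟩; exact mk_eq (.smul_comp h hd i k p q))
    (by rintro ⟨p⟩ ⟨q⟩ ⟨q'⟩; exact mk_eq (.comp_add h hd i p q q'))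
    (by rintro k ⟨p⟩ ⟨q⟩; exact mk_eq (.comp_smul h hd i k p q))

theorem units_smul_eq {M : Type w} [AddCommGroup M] [Module K M] (ε : ℤˣ) (x : M) :
    ε • x = ((ε : ℤ) : K) • x := by
  rw [Units.smul_def, Int.cast_smul_eq_zsmul]

end FreeOperad

open FreeOperad in
/-- The free graded operad `Fr(X)`. -/
def FreeOperad {K : Type u} [Field K] (X : SigmaModule.{u, v} K) :
    GradedOperad.{u, max u v} K where
  V := Carrier X
  act := actRep X
  one := mk .one
  comp := compMap X
  one_comp := by rintro n a h hd ⟨p⟩; exact mk_eq (.one_comp h hd p)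
  comp_one := by rintro n a h hd i ⟨p⟩; exact mk_eq (.comp_one h hd i p)
  comp_act := by
    rintro m n r a b c h hd i σ τ ⟨p⟩ ⟨q⟩
    exact mk_eq (.comp_act h hd i σ τ p q)
  comp_assoc := by
    rintro m n l s t r a b c d e f h₁ h₂ h₃ h₄ d₁ d₂ d₃ d₄ i j ⟨p⟩ ⟨q⟩ ⟨t⟩
    exact mk_eq (.comp_assoc h₁ h₂ h₃ h₄ d₁ d₂ d₃ d₄ i j p q t)
  comp_comm := by
    rintro m n l s t r a b c d e f h₁ h₂ h₃ h₄ d₁ d₂ d₃ d₄ i j hji hij ⟨p⟩ ⟨q⟩ ⟨t⟩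
    rw [units_smul_eq (K := K)]
    exact mk_eq (.comp_comm h₁ h₂ h₃ h₄ d₁ d₂ d₃ d₄ i j hji hij p q t)

namespace FreeOperad

variable {K : Type u} [Field K] {X : SigmaModule.{u, v} K}

/-- The inclusion of generators `X → Fr(X)`. -/
def gen {n : ℕ} {d : ℤ} : X.V n d →ₗ[K] (FreeOperad X).V n d where
  toFun x := mk (.gen x)
  map_add' x y := mk_eq (.gen_add x y)
  map_smul' c x := mk_eq (.gen_smul c x)

theorem gen_act {n : ℕ} {d : ℤ} (σ : Equiv.Perm (Fin n)) (x : X.V n d) :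
    gen (X.act n d σ x) = (FreeOperad X).act n d σ (gen x) :=
  mk_eq (.gen_act σ x)

/-! #### The universal property: extension of morphisms from generators -/

/-- The value of a formal expression, given the values of the generators. -/
def termValue (Q : GradedOperad.{u, w} K) (g : ∀ {n : ℕ} {d : ℤ}, X.V n d →ₗ[K] Q.V n d) :
    ∀ {n : ℕ} {d : ℤ}, Term X n d → Q.V n d
  | _, _, .gen x => g x
  | _, _, .one => Q.one
  | _, _, .zero => 0
  | _, _, .add p q => termValue Q g p + termValue Q g q
  | _, _, .smul c p => c • termValue Q g p
  | _, _, .act σ p => Q.act _ _ σ (termValue Q g p)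
  | _, _, .comp h hd i p q => Q.comp h hd i (termValue Q g p) (termValue Q g q)

theorem termValue_rel (Q : GradedOperad.{u, w} K)
    (g : ∀ {n : ℕ} {d : ℤ}, X.V n d →ₗ[K] Q.V n d)
    (hg : ∀ {n : ℕ} {d : ℤ} (σ : Equiv.Perm (Fin n)) (x : X.V n d),
      g (X.act n d σ x) = Q.act n d σ (g x))
    {n : ℕ} {d : ℤ} {p q : Term X n d} (h : Rel X p q) :
    termValue Q g p = termValue Q g q := by
  induction h with
  | refl => rfl
  | symm _ ih => exact ih.symm
  | trans _ _ ih ih' => exact ih.trans ih'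
  | add_congr _ _ ih ih' => simp only [termValue, ih, ih']
  | smul_congr _ _ ih => simp only [termValue, ih]
  | act_congr _ _ ih => simp only [termValue, ih]
  | comp_congr _ _ _ _ _ ih ih' => simp only [termValue, ih, ih']
  | add_comm => exact add_comm _ _
  | add_assoc => exact add_assoc _ _ _
  | zero_add => exact zero_add _
  | zero_smul => exact zero_smul _ _
  | one_smul => exact one_smul _ _
  | mul_smul => exact mul_smul _ _ _
  | add_smul => exact add_smul _ _ _
  | smul_add => exact smul_add _ _ _
  | gen_add => exact map_add _ _ _
  | gen_smul => exact map_smul _ _ _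
  | gen_act => exact hg _ _
  | act_add => exact map_add _ _ _
  | act_smul => exact map_smul _ _ _
  | one_act => simp [termValue]
  | mul_act => simp [termValue]
  | add_comp => simp [termValue]
  | smul_comp => simp [termValue]
  | comp_add => simp [termValue]
  | comp_smul => simp [termValue]
  | one_comp => exact Q.one_comp _ _ _
  | comp_one => exact Q.comp_one _ _ _ _
  | comp_act => exact Q.comp_act _ _ _ _ _ _ _
  | comp_assoc h₁ h₂ h₃ h₄ d₁ d₂ d₃ d₄ i j p q t =>
    exact Q.comp_assoc h₁ h₂ h₃ h₄ d₁ d₂ d₃ d₄ i j _ _ _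
  | comp_comm h₁ h₂ h₃ h₄ d₁ d₂ d₃ d₄ i j hji hij p q t =>
    refine (Q.comp_comm h₁ h₂ h₃ h₄ d₁ d₂ d₃ d₄ i j hji hij _ _ _).trans ?_
    rw [units_smul_eq (K := K)]
    rfl

/-- The operad morphism `Fr(X) → Q` extending a morphism of graded `Σ`-modules `X → Q`. -/
def lift (Q : GradedOperad.{u, w} K) (g : ∀ {n : ℕ} {d : ℤ}, X.V n d →ₗ[K] Q.V n d)
    (hg : ∀ {n : ℕ} {d : ℤ} (σ : Equiv.Perm (Fin n)) (x : X.V n d),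
      g (X.act n d σ x) = Q.act n d σ (g x)) :
    GradedOperad.Hom (FreeOperad X) Q where
  map :=
    { toFun := Quot.lift (termValue Q g) (fun _ _ h => termValue_rel Q g hg h)
      map_add' := by rintro ⟨p⟩ ⟨q⟩; rfl
      map_smul' := by rintro c ⟨p⟩; rfl }
  map_one := rfl
  map_act := by rintro n d σ ⟨p⟩; rfl
  map_comp := by rintro m n r a b c h hd i ⟨p⟩ ⟨q⟩; rfl

/-! #### Extension of derivations from generators -/

section Derivation

variable {Q : GradedOperad.{u, w} K} (f : GradedOperad.Hom (FreeOperad X) Q) (e : ℤ)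
  (δ : ∀ {n : ℕ} {a b : ℤ}, a + e = b → (X.V n a →ₗ[K] Q.V n b))

/-- The value on a formal expression of the derivation of degree `e` along `f` with the values
`δ` on generators. -/
def derTerm : ∀ {n : ℕ} {a : ℤ}, Term X n a → ∀ {b : ℤ}, a + e = b → Q.V n b
  | _, _, .gen x, _, h => δ h x
  | _, _, .one, _, _ => 0
  | _, _, .zero, _, _ => 0
  | _, _, .add p q, _, h => derTerm p h + derTerm q h
  | _, _, .smul c p, _, h => c • derTerm p h
  | _, _, .act σ p, _, h => Q.act _ _ σ (derTerm p h)
  | _, _, .comp (a := a) (b := b) hn hd i p q, _, h =>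
      Q.comp hn (by omega) i (derTerm p (b := a + e) rfl) (f.map (mk q)) +
        (e * a).negOnePow •
          Q.comp hn (by omega) i (f.map (mk p)) (derTerm q (b := b + e) rfl)

theorem derTerm_rel
    (hδ : ∀ {n : ℕ} {a b : ℤ} (h : a + e = b) (σ : Equiv.Perm (Fin n)) (x : X.V n a),
      δ h (X.act n a σ x) = Q.act n b σ (δ h x))
    {n : ℕ} {a : ℤ} {p q : Term X n a} (hpq : Rel X p q) :
    ∀ {b : ℤ} (h : a + e = b), derTerm f e δ p h = derTerm f e δ q h := by
  have hf : ∀ {n : ℕ} {d : ℤ} {p q : Term X n d}, Rel X p q → f.map (mk p) = f.map (mk q) :=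
    fun h => by rw [mk_eq h]
  have fadd : ∀ {n : ℕ} {d : ℤ} (p q : Term X n d),
      f.map (mk (.add p q)) = f.map (mk p) + f.map (mk q) := fun p q => f.map.map_add (mk p) (mk q)
  have fsmul : ∀ {n : ℕ} {d : ℤ} (c : K) (p : Term X n d),
      f.map (mk (.smul c p)) = c • f.map (mk p) := fun c p => f.map.map_smul c (mk p)
  have fact : ∀ {n : ℕ} {d : ℤ} (σ : Equiv.Perm (Fin n)) (p : Term X n d),
      f.map (mk (.act σ p)) = Q.act n d σ (f.map (mk p)) := fun σ p => f.map_act σ (mk p)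
  have fone : f.map (mk .one) = Q.one := f.map_one
  have fcomp : ∀ {m n r : ℕ} {a b c : ℤ} (h : m + n = r + 1) (hd : a + b = c) (i : Fin m)
      (p : Term X m a) (q : Term X n b),
      f.map (mk (.comp h hd i p q)) = Q.comp h hd i (f.map (mk p)) (f.map (mk q)) :=
    fun h hd i p q => f.map_comp h hd i (mk p) (mk q)
  induction hpq with
  | refl => intros; rfl
  | symm _ ih => intro b h; exact (ih h).symm
  | trans _ _ ih ih' => intro b h; exact (ih h).trans (ih' h)
  | add_congr _ _ ih ih' => intro b h; simp only [derTerm, ih, ih']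
  | smul_congr _ _ ih => intro b h; simp only [derTerm, ih]
  | act_congr _ _ ih => intro b h; simp only [derTerm, ih]
  | comp_congr _ _ _ hp hq ih ih' => intro b h; simp only [derTerm, ih, ih', hf hp, hf hq]
  | add_comm => intro b h; exact add_comm _ _
  | add_assoc => intro b h; exact add_assoc _ _ _
  | zero_add => intro b h; exact zero_add _
  | zero_smul => intro b h; exact zero_smul _ _
  | one_smul => intro b h; exact one_smul _ _
  | mul_smul => intro b h; exact mul_smul _ _ _
  | add_smul => intro b h; exact add_smul _ _ _
  | smul_add => intro b h; exact smul_add _ _ _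
  | gen_add => intro b h; exact map_add _ _ _
  | gen_smul => intro b h; exact map_smul _ _ _
  | gen_act => intro b h; exact hδ _ _ _
  | act_add => intro b h; exact map_add _ _ _
  | act_smul => intro b h; exact map_smul _ _ _
  | one_act => intro b h; simp [derTerm]
  | mul_act => intro b h; simp [derTerm]
  | add_comp => intro b h; simp only [derTerm, fadd, map_add, LinearMap.add_apply, smul_add]; abel
  | smul_comp =>
    intro b h
    simp only [derTerm, fsmul, map_smul, LinearMap.smul_apply, smul_add]
    rw [smul_comm]
  | comp_add => intro b h; simp only [derTerm, fadd, map_add, smul_add]; abel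
  | comp_smul =>
    intro b h
    simp only [derTerm, fsmul, map_smul, smul_add]
    rw [smul_comm]
  | one_comp h hd p =>
    rintro b rfl
    simp [derTerm, fone, Q.one_comp]
  | comp_one h hd i p =>
    rintro b rfl
    simp [derTerm, fone, Q.comp_one]
  | comp_act =>
    intro b h
    simp only [derTerm, fact, Q.comp_act, map_add, Units.smul_def, map_zsmul]
  | @comp_assoc m n l s' t' r a b c d k g h₁ h₂ h₃ h₄ d₁ d₂ d₃ d₄ i j p q t =>
    intro b' h
    have E1 := Q.comp_assoc h₁ h₂ h₃ h₄ (a := a + e) (d := d + e) (f := b') (by omega) (by omega)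
      d₃ (by omega) i j (derTerm f e δ p rfl) (f.map (mk q)) (f.map (mk t))
    have E2 := Q.comp_assoc h₁ h₂ h₃ h₄ (b := b + e) (d := d + e) (e := k + e) (f := b') (by omega)
      (by omega) (by omega) (by omega) i j (f.map (mk p)) (derTerm f e δ q rfl) (f.map (mk t))
    have E3 := Q.comp_assoc h₁ h₂ h₃ h₄ (c := c + e) (e := k + e) (f := b') d₁
      (by omega) (by omega) (by omega) i j (f.map (mk p)) (f.map (mk q)) (derTerm f e δ t rfl)
    simp only [derTerm, fcomp, map_add, LinearMap.add_apply, smul_add, Units.smul_def, map_zsmul,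
      LinearMap.smul_apply, E1, E2, E3]
    subst d₁
    simp only [mul_add, Int.negOnePow_add, Units.val_mul, mul_smul, add_assoc]
  | @comp_comm m n l s' t' r a b c d k g h₁ h₂ h₃ h₄ d₁ d₂ d₃ d₄ i j hji hij p q t =>
    intro b' h
    have E1 := Q.comp_comm h₁ h₂ h₃ h₄ (a := a + e) (d := d + e) (e := k + e) (f := b') (by omega)
      (by omega) (by omega) (by omega) i j hji hij
      (derTerm f e δ p rfl) (f.map (mk q)) (f.map (mk t))
    have E2 := Q.comp_comm h₁ h₂ h₃ h₄ (b := b + e) (d := d + e) (f := b') (by omega)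
      (by omega) d₃ (by omega) i j hji hij
      (f.map (mk p)) (derTerm f e δ q rfl) (f.map (mk t))
    have E3 := Q.comp_comm h₁ h₂ h₃ h₄ (c := c + e) (e := k + e) (f := b') d₁
      (by omega) (by omega) (by omega) i j hji hij
      (f.map (mk p)) (f.map (mk q)) (derTerm f e δ t rfl)
    simp only [derTerm, fcomp, map_add, LinearMap.add_apply, smul_add, units_smul_eq (K := K),
      map_smul, LinearMap.smul_apply, E1, E2, E3]
    have hs : ∀ x : ℤ, ((x.negOnePow : ℤ) : K) * ((x.negOnePow : ℤ) : K) = 1 := by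
      intro x
      rw [← Int.cast_mul, ← Units.val_mul, ← Int.negOnePow_add, ← two_mul,
        Int.negOnePow_two_mul]
      simp
    subst d₁ d₃
    simp only [mul_add, add_mul, Int.negOnePow_add, Units.val_mul, Int.cast_mul, smul_smul]
    have h1 := hs (e * c)
    have h2 := hs (b * e)
    rw [mul_comm e b, add_right_comm]
    congr 2
    · congr 1
      linear_combination (((e * a).negOnePow : ℤ) : K) * (((b * c).negOnePow : ℤ) : K) * h2
    · ring

/-- The derivation of degree `e` along `f : Fr(X) → Q` extending the equivariant linear maps
`δ` of degree `e` on generators. -/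
def derivation
    (hδ : ∀ {n : ℕ} {a b : ℤ} (h : a + e = b) (σ : Equiv.Perm (Fin n)) (x : X.V n a),
      δ h (X.act n a σ x) = Q.act n b σ (δ h x)) :
    GradedOperad.Derivation f e where
  map h :=
    { toFun := Quot.lift (fun p => derTerm f e δ p h) (fun _ _ hpq => derTerm_rel f e δ hδ hpq h)
      map_add' := by rintro ⟨p⟩ ⟨q⟩; rfl
      map_smul' := by rintro c ⟨p⟩; rfl }
  map_act := by rintro n a b h σ ⟨p⟩; rfl
  leibniz := by
    rintro m n r a b c a' b' c' h hd rfl rfl hc hl hr i ⟨p⟩ ⟨q⟩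
    rfl

end Derivation

end FreeOperad

/-! ### Quasi-free cofibrant dg operads -/

section Cofibrant

variable {K : Type u} [Field K]

/-- A degree `1` derivation `∂` of the free operad `Fr(X)` has a Sullivan grading of the
generators: a decomposition `X = ⨁_{i ≥ 0} X_[i]` into graded sub-`Σ`-modules such that
`∂ X_[i] ⊆ Fr(⨁_{j < i} X_[j])`, the latter being the suboperad of `Fr(X)` generated by the
`X_[j]`, `j < i`. -/
def HasSullivanGrading (X : SigmaModule.{u, v} K)
    (D : GradedOperad.Derivation (GradedOperad.Hom.id (FreeOperad X)) 1) : Prop :=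
  ∃ F : ℕ → ∀ (n : ℕ) (d : ℤ), Submodule K (X.V n d),
    (∀ i n d (σ : Equiv.Perm (Fin n)), ∀ x ∈ F i n d, X.act n d σ x ∈ F i n d) ∧
    (∀ n d, DirectSum.IsInternal (fun i => F i n d)) ∧
    ∀ i n d, ∀ x ∈ F i n d,
      (FreeOperad X).Generated (fun m e => {y | ∃ j < i, ∃ z ∈ F j m e, FreeOperad.gen z = y})
        (D.map (rfl : d + 1 = d + 1) (FreeOperad.gen x))

/-- `(Fr(X), ∂)` is a dg operad (that is, the degree `1` derivation `∂` is a differential),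
and this quasi-free dg operad is cofibrant (that is, it has a Sullivan grading). -/
def IsQuasiFreeCofibrant (X : SigmaModule.{u, v} K)
    (D : GradedOperad.Derivation (GradedOperad.Hom.id (FreeOperad X)) 1) : Prop :=
  (∀ {n : ℕ} {a b c : ℤ} (h : a + 1 = b) (h' : b + 1 = c) (p : (FreeOperad X).V n a),
    D.map h' (D.map h p) = 0) ∧
  HasSullivanGrading X D

end Cofibrant

/-! ### The operad `D_k R` -/

namespace SigmaModule

variable {K : Type u} [Field K]

/-- Identification of components whose degrees are equal. -/
def castDeg (X : SigmaModule.{u, v} K) {n : ℕ} {a b : ℤ} (h : a = b) : X.V n a →ₗ[K] X.V n b :=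
  h ▸ LinearMap.id

theorem castDeg_rfl (X : SigmaModule.{u, v} K) {n : ℕ} {a : ℤ} (h : a = a) (x : X.V n a) :
    X.castDeg h x = x := rfl

theorem castDeg_act (X : SigmaModule.{u, v} K) {n : ℕ} {a b : ℤ} (h : a = b)
    (σ : Equiv.Perm (Fin n)) (x : X.V n a) :
    X.castDeg h (X.act n a σ x) = X.act n b σ (X.castDeg h x) := by
  subst h; rfl

/-- The `m`-fold suspension: `(↑^m X)^d = X^{d - m}` in every arity. -/
def suspension (X : SigmaModule.{u, v} K) (m : ℤ) : SigmaModule.{u, v} K where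
  V n d := X.V n (d - m)
  act n d := X.act n (d - m)

/-- The direct sum `X ⊕ Φ ⊕ ↑^{k-1} X`, where `Φ = K{φ}` is one-dimensional, spanned by `φ` of
arity `1` and degree `k`: the functions from the proofs of `n = 1 ∧ d = k` to `K` form `K` if
`(n, d) = (1, k)` and `0` otherwise. -/
def addDerivation (X : SigmaModule.{u, v} K) (k : ℤ) : SigmaModule.{u, max u v} K where
  V n d := X.V n d × (PLift (n = 1 ∧ d = k) → K) × (X.suspension (k - 1)).V n d
  act n d :=
    { toFun := fun σ => (X.act n d σ).prodMap
        (LinearMap.id.prodMap ((X.suspension (k - 1)).act n d σ))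
      map_one' := by ext <;> simp
      map_mul' := by intro σ τ; ext <;> simp }

/-- The inclusion `X → X ⊕ Φ ⊕ ↑^{k-1} X`. -/
def inX (X : SigmaModule.{u, v} K) (k : ℤ) {n : ℕ} {d : ℤ} :
    X.V n d →ₗ[K] (X.addDerivation k).V n d :=
  LinearMap.inl K (X.V n d) ((PLift (n = 1 ∧ d = k) → K) × (X.suspension (k - 1)).V n d)

/-- The element `φ` of `X ⊕ Φ ⊕ ↑^{k-1} X`. -/
def phi (X : SigmaModule.{u, v} K) (k : ℤ) : (X.addDerivation k).V 1 k :=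
  ((0, fun _ => 1, 0) : X.V 1 k × (PLift (1 = 1 ∧ k = k) → K) × (X.suspension (k - 1)).V 1 k)

/-- The map `x ↦ ↑^{k-1} x` of degree `k - 1` from `X` to `X ⊕ Φ ⊕ ↑^{k-1} X`. -/
def inU (X : SigmaModule.{u, v} K) (k : ℤ) {n : ℕ} {a b : ℤ} (h : a + (k - 1) = b) :
    X.V n a →ₗ[K] (X.addDerivation k).V n b :=
  LinearMap.inr K (X.V n b) ((PLift (n = 1 ∧ b = k) → K) × (X.suspension (k - 1)).V n b) ∘ₗ
    LinearMap.inr K (PLift (n = 1 ∧ b = k) → K) ((X.suspension (k - 1)).V n b) ∘ₗ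
      X.castDeg (show a = b - (k - 1) by omega)

theorem inX_act (X : SigmaModule.{u, v} K) (k : ℤ) {n : ℕ} {d : ℤ} (σ : Equiv.Perm (Fin n))
    (x : X.V n d) :
    X.inX k (X.act n d σ x) = (X.addDerivation k).act n d σ (X.inX k x) := by
  change (X.act n d σ x, 0, 0) =
    (X.act n d σ x, 0, (X.suspension (k - 1)).act n d σ 0)
  rw [map_zero]

theorem inU_act (X : SigmaModule.{u, v} K) (k : ℤ) {n : ℕ} {a b : ℤ} (h : a + (k - 1) = b)
    (σ : Equiv.Perm (Fin n)) (x : X.V n a) :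
    X.inU k h (X.act n a σ x) = (X.addDerivation k).act n b σ (X.inU k h x) := by
  obtain rfl : a = b - (k - 1) := by omega
  change (0, 0, X.act n _ σ x) = (X.act n b σ 0, 0, X.act n _ σ x)
  rw [map_zero]

end SigmaModule

namespace DkR

variable {K : Type u} [Field K] (X : SigmaModule.{u, v} K) (k : ℤ)

/-- The underlying graded operad `Fr(X ⊕ Φ ⊕ ↑^{k-1} X)` of `D_k R`, for `R = (Fr(X), ∂)`. -/
abbrev operad : GradedOperad.{u, max u v} K := FreeOperad (X.addDerivation k)

/-- The generator `x`, for `x ∈ X`. -/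
def genX {n : ℕ} {d : ℤ} : X.V n d →ₗ[K] (operad X k).V n d :=
  FreeOperad.gen ∘ₗ X.inX k

/-- The generator `φ`. -/
def phi : (operad X k).V 1 k :=
  FreeOperad.gen (X.phi k)

/-- The generator `x̲ = ↑^{k-1} x`, of degree `|x| + k - 1`, for `x ∈ X`. -/
def genU {n : ℕ} {a b : ℤ} (h : a + (k - 1) = b) : X.V n a →ₗ[K] (operad X k).V n b :=
  FreeOperad.gen ∘ₗ X.inU k h

theorem genX_act {n : ℕ} {d : ℤ} (σ : Equiv.Perm (Fin n)) (x : X.V n d) :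
    genX X k (X.act n d σ x) = (operad X k).act n d σ (genX X k x) := by
  simp only [genX, LinearMap.comp_apply, X.inX_act, FreeOperad.gen_act]

theorem genU_act {n : ℕ} {a b : ℤ} (h : a + (k - 1) = b) (σ : Equiv.Perm (Fin n))
    (x : X.V n a) :
    genU X k h (X.act n a σ x) = (operad X k).act n b σ (genU X k h x) := by
  simp only [genU, LinearMap.comp_apply, X.inU_act, FreeOperad.gen_act]

/-- The inclusion `Fr(X) → D_k R`. -/
def incl : GradedOperad.Hom (FreeOperad X) (operad X k) :=
  FreeOperad.lift (operad X k) (genX X k) (genX_act X k)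

theorem incl_gen {n : ℕ} {d : ℤ} (x : X.V n d) :
    (incl X k).map (FreeOperad.gen x) = genX X k x := rfl

/-- The derivation `s : Fr(X) → D_k R` of degree `k - 1` along the inclusion, with
`s(x) = x̲` for `x ∈ X`. -/
def s : GradedOperad.Derivation (incl X k) (k - 1) :=
  FreeOperad.derivation (incl X k) (k - 1) (genU X k) (genU_act X k)

theorem s_gen {n : ℕ} {a b : ℤ} (h : a + (k - 1) = b) (x : X.V n a) :
    (s X k).map h (FreeOperad.gen x) = genU X k h x := rfl

/-- The expression `φ ∘₁ p - (-1)^{k|p|} ∑ᵢ p ∘ᵢ φ`. -/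
def bracket {n : ℕ} {a b : ℤ} (h : a + k = b) :
    (operad X k).V n a →ₗ[K] (operad X k).V n b :=
  (operad X k).comp (by omega) (by omega) 0 (phi X k) -
    (((k * a).negOnePow : ℤ) : K) •
      ∑ i : Fin n, ((operad X k).comp rfl h i).flip (phi X k)

theorem bracket_apply {n : ℕ} {a b : ℤ} (h : a + k = b) (p : (operad X k).V n a) :
    bracket X k h p = (operad X k).comp (by omega) (by omega) 0 (phi X k) p -
      (k * a).negOnePow • ∑ i : Fin n, (operad X k).comp rfl h i p (phi X k) := by
  simp [bracket, FreeOperad.units_smul_eq (K := K), LinearMap.sum_apply]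

theorem bracket_act {n : ℕ} {a b : ℤ} (h : a + k = b) (σ : Equiv.Perm (Fin n))
    (p : (operad X k).V n a) :
    bracket X k h ((operad X k).act n a σ p) = (operad X k).act n b σ (bracket X k h p) := by
  have h1 : (operad X k).comp (show 1 + n = n + 1 by omega) (show k + a = b by omega) 0
      (phi X k) ((operad X k).act n a σ p) =
      (operad X k).act n b σ ((operad X k).comp (by omega) (by omega) 0 (phi X k) p) := by
    have := (operad X k).comp_act (show 1 + n = n + 1 by omega) (show k + a = b by omega) 0
      1 σ (phi X k) p
    rw [blockPerm_unary_left] at this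
    simpa using this
  have h2 : ∀ i : Fin n, (operad X k).comp rfl h (σ i) ((operad X k).act n a σ p) (phi X k) =
      (operad X k).act n b σ ((operad X k).comp rfl h i p (phi X k)) := by
    intro i
    have := (operad X k).comp_act (r := n) rfl h i σ 1 p (phi X k)
    rw [blockPerm_unary_right] at this
    simpa using this
  rw [bracket_apply, bracket_apply, h1, ← Equiv.sum_comp σ]
  simp only [h2, map_sub, FreeOperad.units_smul_eq (K := K), map_smul, map_sum]

variable (D : GradedOperad.Derivation (GradedOperad.Hom.id (FreeOperad X)) 1)

/-- The values of the differential of `D_k R` on the generators `x̲`: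
`φ ∘₁ x - (-1)^{k|x|} ∑ᵢ x ∘ᵢ φ - (-1)^k s(∂ x)`. -/
def diffU {n : ℕ} {a b : ℤ} (h : a + k = b) : X.V n a →ₗ[K] (operad X k).V n b :=
  bracket X k h ∘ₗ genX X k -
    ((k.negOnePow : ℤ) : K) •
      ((s X k).map (show (a + 1) + (k - 1) = b by omega) ∘ₗ D.map rfl ∘ₗ FreeOperad.gen)

theorem diffU_act {n : ℕ} {a b : ℤ} (h : a + k = b) (σ : Equiv.Perm (Fin n)) (x : X.V n a) :
    diffU X k D h (X.act n a σ x) = (operad X k).act n b σ (diffU X k D h x) := by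
  simp only [diffU, LinearMap.sub_apply, LinearMap.smul_apply, LinearMap.comp_apply, genX_act,
    bracket_act, FreeOperad.gen_act, D.map_act, (s X k).map_act, map_sub, map_smul]

/-- The values of the differential of `D_k R` on generators:
`∂(x) = ∂_R(x)`, `∂(φ) = 0`, `∂(x̲) = φ ∘₁ x - (-1)^{k|x|} ∑ᵢ x ∘ᵢ φ - (-1)^k s(∂_R x)`. -/
def diffGen {n : ℕ} {a b : ℤ} (h : a + 1 = b) :
    (X.addDerivation k).V n a →ₗ[K] (operad X k).V n b :=
  LinearMap.coprod ((incl X k).map ∘ₗ D.map h ∘ₗ FreeOperad.gen)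
    (LinearMap.coprod 0 (diffU X k D (show a - (k - 1) + k = b by omega)))

/-- The differential of `D_k R`: the derivation of degree `1` with the values `diffGen` on
generators. -/
def diff : GradedOperad.Derivation (GradedOperad.Hom.id (operad X k)) 1 :=
  FreeOperad.derivation (GradedOperad.Hom.id (operad X k)) 1 (diffGen X k D) (by
    rintro n a b h σ ⟨x, c, y⟩
    have hx := congrArg (incl X k).map (D.map_act h σ (FreeOperad.gen x))
    rw [← FreeOperad.gen_act, (incl X k).map_act] at hx
    have hy := diffU_act X k D (show a - (k - 1) + k = b by omega) σ y
    change (incl X k).map (D.map h (FreeOperad.gen (X.act n a σ x))) +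
      (0 + diffU X k D _ (X.act n (a - (k - 1)) σ y)) =
      (operad X k).act n b σ ((incl X k).map (D.map h (FreeOperad.gen x)) +
        (0 + diffU X k D _ y))
    rw [hx, hy, zero_add, zero_add, map_add])

theorem diff_genX {n : ℕ} {a b : ℤ} (h : a + 1 = b) (x : X.V n a) :
    (diff X k D).map h (genX X k x) = (incl X k).map (D.map h (FreeOperad.gen x)) := by
  change (incl X k).map (D.map h (FreeOperad.gen x)) + (0 + diffU X k D _ 0) = _
  rw [map_zero, zero_add, add_zero]

theorem diff_phi {b : ℤ} (h : k + 1 = b) : (diff X k D).map h (phi X k) = 0 := by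
  change (incl X k).map (D.map h (FreeOperad.gen 0)) + (0 + diffU X k D _ 0) = _
  simp only [map_zero, zero_add]

theorem diff_genU {n : ℕ} {a b c : ℤ} (h : a + (k - 1) = b) (h' : b + 1 = c) (x : X.V n a) :
    (diff X k D).map h' (genU X k h x) =
      (operad X k).comp (by omega) (by omega) 0 (phi X k) (genX X k x) -
        (k * a).negOnePow •
          ∑ i : Fin n, (operad X k).comp rfl (by omega) i (genX X k x) (phi X k) -
        k.negOnePow •
          (s X k).map (show (a + 1) + (k - 1) = c by omega) (D.map rfl (FreeOperad.gen x)) := by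
  obtain rfl : a = b - (k - 1) := by omega
  change (incl X k).map (D.map h' (FreeOperad.gen 0)) + (0 + diffU X k D _ x) = _
  simp only [map_zero, zero_add, diffU, LinearMap.sub_apply, LinearMap.smul_apply,
    LinearMap.comp_apply, bracket_apply, FreeOperad.units_smul_eq (K := K)]

end DkR

namespace FreeOperad

variable {K : Type u} [Field K] {X : SigmaModule.{u, v} K}

/-- Structural induction for elements of the free operad. -/
theorem induction {motive : ∀ {n : ℕ} {d : ℤ}, (FreeOperad X).V n d → Prop}
    (gen : ∀ {n : ℕ} {d : ℤ} (x : X.V n d), motive (gen x))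
    (one : motive (FreeOperad X).one)
    (zero : ∀ {n : ℕ} {d : ℤ}, motive (0 : (FreeOperad X).V n d))
    (add : ∀ {n : ℕ} {d : ℤ} (p q : (FreeOperad X).V n d), motive p → motive q → motive (p + q))
    (smul : ∀ {n : ℕ} {d : ℤ} (c : K) (p : (FreeOperad X).V n d), motive p → motive (c • p))
    (act : ∀ {n : ℕ} {d : ℤ} (σ : Equiv.Perm (Fin n)) (p : (FreeOperad X).V n d), motive p →
      motive ((FreeOperad X).act n d σ p))
    (comp : ∀ {m n r : ℕ} {a b c : ℤ} (h : m + n = r + 1) (hd : a + b = c) (i : Fin m)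
      (p : (FreeOperad X).V m a) (q : (FreeOperad X).V n b), motive p → motive q →
      motive ((FreeOperad X).comp h hd i p q))
    {n : ℕ} {d : ℤ} (p : (FreeOperad X).V n d) : motive p := by
  obtain ⟨t, rfl⟩ := mk_surjective p
  induction t with
  | gen x => exact gen x
  | one => exact one
  | zero => exact zero
  | add p q hp hq => exact add _ _ hp hq
  | smul c p hp => exact smul c _ hp
  | act σ p hp => exact act σ _ hp
  | comp h hd i p q hp hq => exact comp h hd i _ _ hp hq

end FreeOperad

namespace GradedOperad

variable {K : Type u} [Field K]

theorem Derivation.map_one {P : GradedOperad.{u, v} K} {Q : GradedOperad.{u, w} K} {f : Hom P Q}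
    {e : ℤ} (D : Derivation f e) {b : ℤ} (h : 0 + e = b) : D.map h P.one = 0 := by
  have := D.leibniz (c := 0) (c' := b) (show 1 + 1 = 1 + 1 from rfl) (by omega) h h h (by omega)
    (by omega) 0 P.one P.one
  rw [P.one_comp, f.map_one, Q.one_comp, Q.comp_one, mul_zero, Int.negOnePow_zero, one_smul] at this
  simpa using this

/-- A derivation along a morphism preserves generated suboperads if it does so on generators. -/
theorem Generated.derivation {P : GradedOperad.{u, v} K} {Q : GradedOperad.{u, w} K} {f : Hom P Q}
    {e : ℤ} (D : Derivation f e) {G : ∀ n d, Set (P.V n d)} {H : ∀ n d, Set (Q.V n d)}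
    (hf : ∀ n d, ∀ p ∈ G n d, Q.Generated H (f.map p))
    (hD : ∀ n a b (h : a + e = b), ∀ p ∈ G n a, Q.Generated H (D.map h p))
    {n : ℕ} {a : ℤ} {p : P.V n a} (hp : P.Generated G p) :
    Q.Generated H (f.map p) ∧ ∀ {b : ℤ} (h : a + e = b), Q.Generated H (D.map h p) := by
  induction hp with
  | of p hp => exact ⟨hf _ _ _ hp, fun h => hD _ _ _ h _ hp⟩
  | one => exact ⟨by rw [f.map_one]; exact .one, fun h => by rw [D.map_one]; exact .zero⟩
  | zero => exact ⟨by rw [map_zero]; exact .zero, fun h => by rw [map_zero]; exact .zero⟩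
  | add _ _ ihp ihq =>
    exact ⟨by rw [map_add]; exact .add ihp.1 ihq.1,
      fun h => by rw [map_add]; exact .add (ihp.2 h) (ihq.2 h)⟩
  | smul c _ ih =>
    exact ⟨by rw [map_smul]; exact .smul c ih.1,
      fun h => by rw [map_smul]; exact .smul c (ih.2 h)⟩
  | act σ _ ih =>
    exact ⟨by rw [f.map_act]; exact .act σ ih.1,
      fun h => by rw [D.map_act]; exact .act σ (ih.2 h)⟩
  | comp h hd i _ _ ihp ihq =>
    refine ⟨by rw [f.map_comp]; exact .comp h hd i ihp.1 ihq.1, fun h' => ?_⟩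
    rw [D.leibniz h hd rfl rfl h' (by omega) (by omega), FreeOperad.units_smul_eq (K := K)]
    exact .add (.comp _ _ _ (ihp.2 rfl) ihq.1) (.smul _ (.comp _ _ _ ihp.1 (ihq.2 rfl)))

/-- A degree `1` derivation of a free operad squares to zero if it does so on generators. -/
theorem Derivation.sq_zero {X : SigmaModule.{u, v} K}
    (D : Derivation (Hom.id (FreeOperad X)) 1)
    (hD : ∀ {n : ℕ} {a b c : ℤ} (h : a + 1 = b) (h' : b + 1 = c) (x : X.V n a),
      D.map h' (D.map h (FreeOperad.gen x)) = 0)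
    {n : ℕ} {a b c : ℤ} (h : a + 1 = b) (h' : b + 1 = c) (p : (FreeOperad X).V n a) :
    D.map h' (D.map h p) = 0 := by
  induction p using FreeOperad.induction generalizing b c with
  | gen x => exact hD h h' x
  | one => rw [D.map_one, map_zero]
  | zero => rw [map_zero, map_zero]
  | add p q hp hq => rw [map_add, map_add, hp, hq, add_zero]
  | smul c p hp => rw [map_smul, map_smul, hp, smul_zero]
  | act σ p hp => rw [D.map_act, D.map_act, hp, map_zero]
  | @comp m n r a₁ a₂ a hn hd i p q hp hq =>
    rw [D.leibniz hn hd rfl rfl h (by omega) (by omega), map_add,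
      FreeOperad.units_smul_eq (K := K), map_smul,
      D.leibniz hn (c' := c) (by omega) rfl rfl h' (by omega) (by omega),
      D.leibniz hn (c' := c) (by omega) rfl rfl h' (by omega) (by omega), hp, hq]
    simp only [Hom.id, LinearMap.id_apply, map_zero, LinearMap.zero_apply, zero_add, add_zero,
      smul_zero, FreeOperad.units_smul_eq (K := K), one_mul, Int.negOnePow_succ, Units.val_neg,
      Int.cast_neg, neg_smul, neg_add_cancel]

end GradedOperad

theorem inputEquiv_inl_of_unary {m r : ℕ} (h : m + 1 = r + 1) (i j : Fin m) (hij : j ≠ i) :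
    (inputEquiv h i (Sum.inl ⟨j, hij⟩)).1 = j.1 := by
  rw [inputEquiv_inl_val]
  split_ifs <;> simp

namespace DkR

variable {K : Type u} [Field K] (X : SigmaModule.{u, v} K) (k : ℤ)

theorem comp_comp_phi_sum {m n r : ℕ} {a b c a' b' c' : ℤ} (h : m + n = r + 1) (hd : a + b = c)
    (ha : a + k = a') (hb : b + k = b') (hc : c + k = c') (hl : a' + b = c') (hr : a + b' = c')
    (hkb : k + b = b')
    (i : Fin m) (p : (operad X k).V m a) (q : (operad X k).V n b) :
    ∑ j : Fin r, (operad X k).comp rfl hc j ((operad X k).comp h hd i p q) (phi X k) =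
      (b * k).negOnePow • ((operad X k).comp h hl i
        (∑ j : Fin m, (operad X k).comp rfl ha j p (phi X k)) q -
          (operad X k).comp h hr i p ((operad X k).comp (by omega) hkb 0 (phi X k) q)) +
      (operad X k).comp h hr i p (∑ l : Fin n, (operad X k).comp rfl hb l q (phi X k)) := by
  classical
  have hin : ∀ l : Fin n, (operad X k).comp rfl hc (inputEquiv h i (Sum.inr l))
      ((operad X k).comp h hd i p q) (phi X k) =
      (operad X k).comp h hr i p ((operad X k).comp rfl hb l q (phi X k)) := fun l =>
    (operad X k).comp_assoc h rfl rfl h hd hc hb hr i l p q (phi X k)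
  have hout : ∀ (j : Fin m) (hj : j ≠ i),
      (operad X k).comp rfl hc (inputEquiv h i (Sum.inl ⟨j, hj⟩))
        ((operad X k).comp h hd i p q) (phi X k) =
      (b * k).negOnePow • (operad X k).comp h hl i
        ((operad X k).comp rfl ha j p (phi X k)) q := fun j hj => by
    rw [(operad X k).comp_comm h rfl rfl h hd hc ha hl i j hj hj.symm p q (phi X k)]
    rw [show inputEquiv (show m + 1 = m + 1 from rfl) j (Sum.inl ⟨i, hj.symm⟩) = i from
      Fin.ext (inputEquiv_inl_of_unary rfl j i hj.symm)]
  have hself : (operad X k).comp h hl i ((operad X k).comp rfl ha i p (phi X k)) q =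
      (operad X k).comp h hr i p ((operad X k).comp (by omega) hkb 0 (phi X k) q) := by
    rw [← (operad X k).comp_assoc (r := r) (s := m) rfl h (by omega) h ha hl hkb hr i 0 p
      (phi X k) q]
    congr 3
  rw [← Equiv.sum_comp (inputEquiv h i), Fintype.sum_sum_type]
  simp only [hin, map_sum, LinearMap.sum_apply]
  congr 1
  rw [Fintype.sum_eq_add_sum_compl i, hself, add_sub_cancel_left, Finset.smul_sum]
  rw [Finset.sum_congr rfl (fun j _ => hout j.1 j.2)]
  exact (Finset.sum_subtype _ (by simp) fun j => (b * k).negOnePow • (operad X k).comp h hl i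
        ((operad X k).comp rfl ha j p (phi X k)) q).symm

theorem bracket_comp {m n r : ℕ} {a b c a' b' c' : ℤ} (h : m + n = r + 1) (hd : a + b = c)
    (ha : a + k = a') (hb : b + k = b') (hc : c + k = c') (hl : a' + b = c') (hr : a + b' = c')
    (i : Fin m) (p : (operad X k).V m a) (q : (operad X k).V n b) :
    bracket X k hc ((operad X k).comp h hd i p q) =
      (operad X k).comp h hl i (bracket X k ha p) q +
        (k * a).negOnePow • (operad X k).comp h hr i p (bracket X k hb q) := by
  have hφ : (operad X k).comp (show 1 + r = r + 1 by omega) (show k + c = c' by omega) 0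
      (phi X k) ((operad X k).comp h hd i p q) =
      (operad X k).comp h hl i ((operad X k).comp (show 1 + m = m + 1 by omega)
        (show k + a = a' by omega) 0 (phi X k) p) q := by
    rw [← (operad X k).comp_assoc (s := m) (by omega) h h (by omega)
      (show k + a = a' by omega) hl hd (by omega) 0 i (phi X k) p q]
    congr 3
    exact Fin.ext (by simp [inputEquiv_inr_val])
  rw [bracket_apply, bracket_apply, bracket_apply, hφ,
    comp_comp_phi_sum X k h hd ha hb hc hl hr (by omega)]
  obtain rfl := hd
  rw [mul_add, Int.negOnePow_add, mul_comm b k]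
  simp only [FreeOperad.units_smul_eq (K := K), map_sub, map_smul, LinearMap.sub_apply,
    LinearMap.smul_apply]
  rcases Int.units_eq_one_or ((k * a).negOnePow) with h1 | h1 <;>
  rcases Int.units_eq_one_or ((k * b).negOnePow) with h2 | h2 <;>
  · simp only [h1, h2, Units.val_one, Units.val_neg, Int.cast_one, Int.cast_neg, one_mul,
      neg_mul, mul_neg, neg_neg]
    module

/-- The derivation `p ↦ φ ∘₁ p - (-1)^{k|p|} ∑ᵢ p ∘ᵢ φ` of degree `k`. -/
def bracketDerivation :
    GradedOperad.Derivation (GradedOperad.Hom.id (operad X k)) k where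
  map := bracket X k
  map_act := bracket_act X k
  leibniz := bracket_comp X k

variable (D : GradedOperad.Derivation (GradedOperad.Hom.id (FreeOperad X)) 1)

/-- The inclusion `Fr(X) → D_k R` is compatible with the differentials. -/
theorem diff_incl {n : ℕ} {a b : ℤ} (h : a + 1 = b) (p : (FreeOperad X).V n a) :
    (diff X k D).map h ((incl X k).map p) = (incl X k).map (D.map h p) := by
  induction p using FreeOperad.induction generalizing b with
  | gen x => exact diff_genX X k D h x
  | one => rw [(incl X k).map_one, (diff X k D).map_one, D.map_one, map_zero]
  | zero => simp only [map_zero]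
  | add p q hp hq => simp only [map_add, hp, hq]
  | smul c p hp => simp only [map_smul, hp]
  | act σ p hp => rw [(incl X k).map_act, (diff X k D).map_act, hp, D.map_act, (incl X k).map_act]
  | comp hn hd i p q hp hq =>
    rw [(incl X k).map_comp, (diff X k D).leibniz hn hd rfl rfl h (by omega) (by omega), hp, hq,
      D.leibniz hn hd rfl rfl h (by omega) (by omega), map_add,
      FreeOperad.units_smul_eq (K := K), FreeOperad.units_smul_eq (K := K), map_smul,
      (incl X k).map_comp, (incl X k).map_comp]
    rfl

/-- The differential of `bracket p`, where `φ` is a cycle. -/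
theorem diff_bracket {n : ℕ} {a b c d : ℤ} (h : a + k = b) (h' : b + 1 = c) (h₁ : a + 1 = d)
    (h₂ : d + k = c) (p : (operad X k).V n a) :
    (diff X k D).map h' (bracket X k h p) =
      k.negOnePow • bracket X k h₂ ((diff X k D).map h₁ p) := by
  have hsum : ∀ i : Fin n, (diff X k D).map h' ((operad X k).comp rfl h i p (phi X k)) =
      (operad X k).comp rfl h₂ i ((diff X k D).map h₁ p) (phi X k) := fun i => by
    rw [(diff X k D).leibniz rfl h h₁ rfl h' (by omega) (by omega), diff_phi, map_zero, smul_zero,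
      add_zero]
    rfl
  rw [bracket_apply, map_sub, FreeOperad.units_smul_eq (K := K) ((k * a).negOnePow), map_smul,
    map_sum, (diff X k D).leibniz (by omega) (by omega) rfl h₁ h' (by omega) (by omega), diff_phi]
  simp only [hsum, map_zero, LinearMap.zero_apply, zero_add]
  rw [bracket_apply]
  obtain rfl := h₁
  rw [mul_add, mul_one, Int.negOnePow_add, one_mul]
  simp only [FreeOperad.units_smul_eq (K := K), GradedOperad.Hom.id, LinearMap.id_apply]
  rcases Int.units_eq_one_or ((k * a).negOnePow) with h1 | h1 <;>
  rcases Int.units_eq_one_or (k.negOnePow) with h2 | h2 <;>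
  · simp only [h1, h2, Units.val_one, Units.val_neg, Int.cast_one, Int.cast_neg, one_mul,
      neg_mul, mul_neg, neg_neg]
    module

/-- The homotopy formula `∂ s(p) = φ ∘₁ p - (-1)^{k|p|} ∑ᵢ p ∘ᵢ φ - (-1)^k s(∂_R p)`. -/
theorem diff_s {n : ℕ} {a b c d : ℤ} (h : a + (k - 1) = b) (h' : b + 1 = c) (h₁ : a + 1 = d)
    (h₂ : d + (k - 1) = c) (h₃ : a + k = c) (p : (FreeOperad X).V n a) :
    (diff X k D).map h' ((s X k).map h p) =
      bracket X k h₃ ((incl X k).map p) - k.negOnePow • (s X k).map h₂ (D.map h₁ p) := by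
  induction p using FreeOperad.induction generalizing b c d with
  | gen x =>
    obtain rfl := h₁
    rw [s_gen, diff_genU, bracket_apply, incl_gen]
  | one =>
    have := (bracketDerivation X k).map_one h₃
    rw [(incl X k).map_one, (s X k).map_one, D.map_one, map_zero, map_zero, smul_zero, sub_zero]
    exact this.symm
  | zero => simp only [map_zero, smul_zero, sub_zero]
  | add p q hp hq =>
    simp only [map_add, hp h h' h₁ h₂ h₃, hq h h' h₁ h₂ h₃, smul_add]
    abel
  | smul c p hp =>
    simp only [map_smul, hp h h' h₁ h₂ h₃, smul_sub]
    rw [FreeOperad.units_smul_eq (K := K), FreeOperad.units_smul_eq (K := K), smul_smul, smul_smul,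
      mul_comm]
  | act σ p hp =>
    rw [(s X k).map_act, (diff X k D).map_act, hp h h' h₁ h₂ h₃, (incl X k).map_act, bracket_act,
      D.map_act, (s X k).map_act]
    simp only [FreeOperad.units_smul_eq (K := K), map_sub, map_smul]
  | @comp m n r a₁ a₂ a hn hd i p q hp hq =>
    rw [(s X k).leibniz hn hd rfl rfl h (by omega) (by omega), map_add,
      FreeOperad.units_smul_eq (K := K), map_smul,
      (diff X k D).leibniz hn (c' := c) (by omega) rfl rfl h' (by omega) (by omega),
      (diff X k D).leibniz hn (c' := c) (by omega) rfl rfl h' (by omega) (by omega),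
      hp rfl rfl rfl (by omega) (by omega), hq rfl rfl rfl (by omega) (by omega),
      diff_incl, diff_incl, (incl X k).map_comp,
      bracket_comp X k hn hd (a' := a₁ + (k - 1) + 1) (b' := a₂ + (k - 1) + 1) (by omega)
        (by omega) h₃ (by omega) (by omega),
      D.leibniz hn hd rfl rfl h₁ (by omega) (by omega), map_add,
      FreeOperad.units_smul_eq (K := K) (M := (FreeOperad X).V r d), map_smul,
      (s X k).leibniz hn (a' := a₁ + (k - 1) + 1) (b' := a₂ + (k - 1)) (c' := c)
        (by omega) (by omega) (by omega) h₂ (by omega) (by omega),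
      (s X k).leibniz hn (a' := a₁ + (k - 1)) (b' := a₂ + (k - 1) + 1) (c' := c)
        (by omega) (by omega) (by omega) h₂ (by omega) (by omega)]
    simp only [sub_mul, mul_add, mul_sub, mul_one, one_mul, Int.negOnePow_add, Int.negOnePow_sub,
      Int.negOnePow_one, GradedOperad.Hom.id, LinearMap.id_apply,
      FreeOperad.units_smul_eq (K := K), map_sub, map_smul, LinearMap.sub_apply,
      LinearMap.smul_apply]
    rcases Int.units_eq_one_or ((k * a₁).negOnePow) with h1 | h1 <;>
    rcases Int.units_eq_one_or (k.negOnePow) with h2 | h2 <;>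
    rcases Int.units_eq_one_or (a₁.negOnePow) with h3 | h3 <;>
    · simp only [h1, h2, h3, Units.val_one, Units.val_neg, Int.cast_one, Int.cast_neg,
        mul_neg, neg_neg, mul_one]
      module

theorem diff_diff_genU
    (hD : ∀ {n : ℕ} {a b c : ℤ} (h : a + 1 = b) (h' : b + 1 = c) (p : (FreeOperad X).V n a),
      D.map h' (D.map h p) = 0)
    {n : ℕ} {a b c d : ℤ} (h : a + (k - 1) = b) (h' : b + 1 = c) (h'' : c + 1 = d) (x : X.V n a) :
    (diff X k D).map h'' ((diff X k D).map h' (genU X k h x)) = 0 := by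
  rw [← s_gen, diff_s X k D h h' rfl (by omega) (by omega), map_sub,
    diff_bracket X k D _ h'' rfl (by omega), FreeOperad.units_smul_eq (K := K) k.negOnePow ((s X k).map _ _), map_smul,
    diff_s X k D _ h'' rfl (by omega) (by omega), hD, map_zero, smul_zero, sub_zero, diff_incl,
    FreeOperad.units_smul_eq (K := K), sub_self]

/-- The inclusion of `Φ` into `X ⊕ Φ ⊕ ↑^{k-1} X`. -/
def inPhi {n : ℕ} {d : ℤ} (c : PLift (n = 1 ∧ d = k) → K) : (X.addDerivation k).V n d :=
  ((0, c, 0) : X.V n d × (PLift (n = 1 ∧ d = k) → K) × (X.suspension (k - 1)).V n d)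

/-- Every generator is a sum of generators `x`, `c φ` and `y̲`. -/
theorem exists_gen_eq {n : ℕ} {d : ℤ} (z : (X.addDerivation k).V n d) :
    ∃ (x : X.V n d) (c : PLift (n = 1 ∧ d = k) → K) (y : X.V n (d - (k - 1))),
      x = z.1 ∧ y = z.2.2 ∧
      FreeOperad.gen z = genX X k x + (FreeOperad.gen (inPhi X k c) +
        genU X k (show d - (k - 1) + (k - 1) = d by omega) y) := by
  obtain ⟨x, c, y⟩ := z
  refine ⟨x, c, y, rfl, rfl, ?_⟩
  have hz : (show (X.addDerivation k).V n d from (x, c, y)) = X.inX k x +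
      (inPhi X k c + X.inU k (show d - (k - 1) + (k - 1) = d by omega) y) := by
    change (x, c, y) = (x + (0 + 0), 0 + (c + 0), 0 + (0 + y))
    simp only [zero_add, add_zero]
  exact (congrArg FreeOperad.gen hz).trans
    ((map_add _ _ _).trans (congrArg _ (map_add _ _ _)))

theorem diff_gen_phi {n : ℕ} {a b : ℤ} (h : a + 1 = b) (c : PLift (n = 1 ∧ a = k) → K) :
    (diff X k D).map h (FreeOperad.gen (inPhi X k c)) = 0 := by
  change (incl X k).map (D.map h (FreeOperad.gen 0)) + (0 + diffU X k D _ 0) = 0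
  simp only [map_zero, zero_add]

/-- The differential of `D_k R` squares to zero if that of `R` does. -/
theorem diff_diff
    (hD : ∀ {n : ℕ} {a b c : ℤ} (h : a + 1 = b) (h' : b + 1 = c) (p : (FreeOperad X).V n a),
      D.map h' (D.map h p) = 0)
    {n : ℕ} {a b c : ℤ} (h : a + 1 = b) (h' : b + 1 = c) (p : (operad X k).V n a) :
    (diff X k D).map h' ((diff X k D).map h p) = 0 := by
  refine (diff X k D).sq_zero (fun h h' z => ?_) h h' p
  obtain ⟨x, c, y, -, -, hz⟩ := exists_gen_eq X k z
  rw [hz, map_add, map_add, map_add, map_add, diff_gen_phi, map_zero,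
    diff_diff_genU X k D hD, diff_genX, diff_incl, hD, map_zero, add_zero, add_zero]

end DkR

section Decomposition

variable {K M N ι κ : Type*} [Field K] [AddCommGroup M] [Module K M] [AddCommGroup N] [Module K N]

theorem DirectSum.IsInternal.prod [DecidableEq ι] {A : ι → Submodule K M} {B : ι → Submodule K N}
    (hA : DirectSum.IsInternal A) (hB : DirectSum.IsInternal B) :
    DirectSum.IsInternal fun i => (A i).prod (B i) := by
  rw [DirectSum.isInternal_submodule_iff_iSupIndep_and_iSup_eq_top] at hA hB ⊢
  refine ⟨fun i => ?_, ?_⟩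
  · have hle : ⨆ j, ⨆ (_ : j ≠ i), (A j).prod (B j) ≤
        (⨆ j, ⨆ (_ : j ≠ i), A j).prod (⨆ j, ⨆ (_ : j ≠ i), B j) :=
      iSup₂_le fun j hj => Submodule.prod_mono (le_iSup₂_of_le j hj le_rfl)
        (le_iSup₂_of_le j hj le_rfl)
    refine Disjoint.mono_right hle (Submodule.disjoint_def.2 fun x hx hx' => Prod.ext ?_ ?_)
    · exact Submodule.disjoint_def.1 (hA.1 i) _ hx.1 hx'.1
    · exact Submodule.disjoint_def.1 (hB.1 i) _ hx.2 hx'.2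
  · have h₁ : Submodule.map (LinearMap.inl K M N) ⊤ ≤ ⨆ i, (A i).prod (B i) := by
      rw [← hA.2, Submodule.map_iSup]
      refine iSup_mono fun i => ?_
      rintro _ ⟨x, hx, rfl⟩
      exact ⟨hx, zero_mem _⟩
    have h₂ : Submodule.map (LinearMap.inr K M N) ⊤ ≤ ⨆ i, (A i).prod (B i) := by
      rw [← hB.2, Submodule.map_iSup]
      refine iSup_mono fun i => ?_
      rintro _ ⟨x, hx, rfl⟩
      exact ⟨zero_mem _, hx⟩
    refine eq_top_iff.2 fun x _ => ?_
    have := add_mem (h₁ ⟨x.1, trivial, rfl⟩) (h₂ ⟨x.2, trivial, rfl⟩)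
    simpa using this

/-- The family indexed by `κ` with the member `F j` at `e j` and `⊥` outside the range of `e`. -/
def extendByBot (F : ι → Submodule K M) (e : ι → κ) (c : κ) : Submodule K M :=
  ⨆ j, ⨆ (_ : e j = c), F j

theorem extendByBot_apply (F : ι → Submodule K M) {e : ι → κ} (he : Function.Injective e) (j : ι) :
    extendByBot F e (e j) = F j :=
  le_antisymm (iSup₂_le fun _ hj => he hj ▸ le_rfl) (le_iSup₂_of_le j rfl le_rfl)

theorem mem_extendByBot {F : ι → Submodule K M} {e : ι → κ} (he : Function.Injective e) {c : κ}
    {x : M} : x ∈ extendByBot F e c ↔ x = 0 ∨ ∃ j, e j = c ∧ x ∈ F j := by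
  by_cases hc : ∃ j, e j = c
  · obtain ⟨j, rfl⟩ := hc
    rw [extendByBot_apply F he]
    refine ⟨fun hx => .inr ⟨j, rfl, hx⟩, ?_⟩
    rintro (rfl | ⟨j', hj, hx⟩)
    · exact zero_mem _
    · exact he hj ▸ hx
  · have hbot : extendByBot F e c = ⊥ :=
      le_bot_iff.1 (iSup₂_le fun j hj => absurd ⟨j, hj⟩ hc)
    rw [hbot, Submodule.mem_bot]
    exact ⟨.inl, fun h => h.resolve_right fun ⟨j, hj, _⟩ => hc ⟨j, hj⟩⟩

theorem isInternal_extendByBot [DecidableEq ι] [DecidableEq κ] {F : ι → Submodule K M}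
    (hF : DirectSum.IsInternal F) {e : ι → κ} (he : Function.Injective e) :
    DirectSum.IsInternal (extendByBot F e) := by
  rw [DirectSum.isInternal_submodule_iff_iSupIndep_and_iSup_eq_top] at hF ⊢
  refine ⟨fun c => ?_, eq_top_iff.2 ?_⟩
  · refine Submodule.disjoint_def.2 fun x hx hx' => ?_
    obtain rfl | ⟨j, rfl, hxj⟩ := (mem_extendByBot he).1 hx
    · rfl
    refine Submodule.disjoint_def.1 (hF.1 j) x hxj ?_
    refine (iSup₂_le fun c hc => iSup₂_le fun j' hj' => ?_ :
      ⨆ c, ⨆ (_ : c ≠ e j), extendByBot F e c ≤ _) hx'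
    exact le_iSup₂_of_le j' (fun h => hc (by rw [← hj', h])) le_rfl
  · rw [← hF.2]
    exact iSup_le fun j => le_iSup_of_le (e j) (extendByBot_apply F he j).ge

theorem isInternal_top_unit : DirectSum.IsInternal fun _ : Unit => (⊤ : Submodule K M) := by
  rw [DirectSum.isInternal_submodule_iff_iSupIndep_and_iSup_eq_top]
  exact ⟨iSupIndep_subsingleton _, iSup_const⟩

end Decomposition

namespace DkR

variable {K : Type u} [Field K] (X : SigmaModule.{u, v} K) (k : ℤ)

/-- The grading of the generators of `D_k R` in which the degrees of `x ∈ X_[i]` and of `x̲` are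
`2 i` and `2 i + 1`, that of `φ` is `0`. -/
def grading (F : ℕ → ∀ (n : ℕ) (d : ℤ), Submodule K (X.V n d)) (i : ℕ) (n : ℕ) (d : ℤ) :
    Submodule K ((X.addDerivation k).V n d) :=
  Submodule.prod (p := extendByBot (fun j => F j n d) (fun j => 2 * j) i)
    (q₁ := Submodule.prod
      (p := extendByBot (fun _ : Unit => (⊤ : Submodule K (PLift (n = 1 ∧ d = k) → K)))
        (fun _ => 0) i)
      (q₁ := extendByBot (fun j => F j n (d - (k - 1))) (fun j => 2 * j + 1) i))

theorem injective_two_mul : Function.Injective fun j : ℕ => 2 * j := fun a b h => by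
  simp only at h; omega

theorem injective_two_mul_add_one : Function.Injective fun j : ℕ => 2 * j + 1 := fun a b h => by
  simp only at h; omega

theorem injective_unit_zero : Function.Injective fun _ : Unit => (0 : ℕ) := fun _ _ _ => rfl

variable {X} {F : ℕ → ∀ (n : ℕ) (d : ℤ), Submodule K (X.V n d)}

theorem grading_isInternal (hF : ∀ n d, DirectSum.IsInternal fun i => F i n d) (n : ℕ) (d : ℤ) :
    DirectSum.IsInternal fun i => grading X k F i n d :=
  (isInternal_extendByBot (hF n d) injective_two_mul).prod
    ((isInternal_extendByBot isInternal_top_unit injective_unit_zero).prod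
      (isInternal_extendByBot (hF n (d - (k - 1))) injective_two_mul_add_one))

theorem extendByBot_act
    (hF : ∀ i n d (σ : Equiv.Perm (Fin n)), ∀ x ∈ F i n d, X.act n d σ x ∈ F i n d)
    {e : ℕ → ℕ} (he : Function.Injective e) {i n : ℕ} {d : ℤ} (σ : Equiv.Perm (Fin n))
    {x : X.V n d} (hx : x ∈ extendByBot (fun j => F j n d) e i) :
    X.act n d σ x ∈ extendByBot (fun j => F j n d) e i := by
  rw [mem_extendByBot he] at hx ⊢
  obtain rfl | ⟨j, hj, hx⟩ := hx
  · exact .inl (map_zero _)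
  · exact .inr ⟨j, hj, hF _ _ _ _ _ hx⟩

theorem grading_act
    (hF : ∀ i n d (σ : Equiv.Perm (Fin n)), ∀ x ∈ F i n d, X.act n d σ x ∈ F i n d)
    (i n : ℕ) (d : ℤ) (σ : Equiv.Perm (Fin n)) (z : (X.addDerivation k).V n d)
    (hz : z ∈ grading X k F i n d) : (X.addDerivation k).act n d σ z ∈ grading X k F i n d :=
  ⟨extendByBot_act hF injective_two_mul σ hz.1, hz.2.1,
    extendByBot_act hF injective_two_mul_add_one σ hz.2.2⟩

theorem inX_mem_grading {i n : ℕ} {d : ℤ} {x : X.V n d} (hx : x ∈ F i n d) :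
    X.inX k x ∈ grading X k F (2 * i) n d :=
  ⟨(mem_extendByBot injective_two_mul).2 (.inr ⟨i, rfl, hx⟩), zero_mem _, zero_mem _⟩

theorem inU_mem_grading {i n : ℕ} {a b : ℤ} (h : a + (k - 1) = b) {x : X.V n a}
    (hx : x ∈ F i n a) : X.inU k h x ∈ grading X k F (2 * i + 1) n b := by
  obtain rfl : a = b - (k - 1) := by omega
  exact ⟨zero_mem _, zero_mem _,
    (mem_extendByBot injective_two_mul_add_one).2 (.inr ⟨i, rfl, hx⟩)⟩

theorem phi_mem_grading : X.phi k ∈ grading X k F 0 1 k :=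
  ⟨zero_mem _, (mem_extendByBot injective_unit_zero).2 (.inr ⟨(), rfl, trivial⟩), zero_mem _⟩

variable (X F) in
/-- The generators of filtration degree less than `i`. -/
def lowerGen (i n : ℕ) (d : ℤ) : Set ((operad X k).V n d) :=
  {y | ∃ j < i, ∃ z ∈ grading X k F j n d, FreeOperad.gen z = y}

theorem genX_generated {i j n : ℕ} {d : ℤ} (hij : 2 * j < i) {x : X.V n d} (hx : x ∈ F j n d) :
    (operad X k).Generated (lowerGen X k F i) (genX X k x) :=
  .of _ ⟨_, hij, _, inX_mem_grading k hx, rfl⟩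

theorem genU_generated {i j n : ℕ} {a b : ℤ} (hij : 2 * j + 1 < i) (h : a + (k - 1) = b)
    {x : X.V n a} (hx : x ∈ F j n a) :
    (operad X k).Generated (lowerGen X k F i) (genU X k h x) :=
  .of _ ⟨_, hij, _, inU_mem_grading k h hx, rfl⟩

theorem phi_generated {i : ℕ} (hi : 0 < i) :
    (operad X k).Generated (lowerGen X k F i) (phi X k) :=
  .of _ ⟨_, hi, _, phi_mem_grading k, rfl⟩

theorem incl_s_generated {i m n : ℕ} (him : 2 * i ≤ m) {a : ℤ} {p : (FreeOperad X).V n a}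
    (hp : (FreeOperad X).Generated
      (fun n d => {y | ∃ j < i, ∃ z ∈ F j n d, FreeOperad.gen z = y}) p) :
    (operad X k).Generated (lowerGen X k F m) ((incl X k).map p) ∧
      ∀ {b : ℤ} (h : a + (k - 1) = b),
        (operad X k).Generated (lowerGen X k F m) ((s X k).map h p) := by
  refine hp.derivation (s X k) ?_ ?_
  · rintro n d _ ⟨j, hj, z, hz, rfl⟩
    exact genX_generated k (by omega) hz
  · rintro n a b h _ ⟨j, hj, z, hz, rfl⟩
    exact genU_generated k (by omega) h hz

theorem bracket_generated {i n : ℕ} (hi : 0 < i) {a b : ℤ} (h : a + k = b)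
    {p : (operad X k).V n a} (hp : (operad X k).Generated (lowerGen X k F i) p) :
    (operad X k).Generated (lowerGen X k F i) (bracket X k h p) := by
  rw [bracket_apply, sub_eq_add_neg, FreeOperad.units_smul_eq (K := K), ← neg_smul]
  refine .add (.comp _ _ _ (phi_generated k hi) hp) (.smul _ ?_)
  refine Finset.sum_induction _ (fun q => (operad X k).Generated (lowerGen X k F i) q)
    (fun _ _ => .add) .zero fun j _ => .comp _ _ _ hp (phi_generated k hi)

theorem hasSullivanGrading_diff {D : GradedOperad.Derivation (GradedOperad.Hom.id (FreeOperad X)) 1}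
    (hR : HasSullivanGrading X D) : HasSullivanGrading (X.addDerivation k) (diff X k D) := by
  obtain ⟨F, hact, hF, hD⟩ := hR
  refine ⟨grading X k F, grading_act k hact, grading_isInternal k hF, ?_⟩
  intro i n d z hz
  obtain ⟨x, c, y, hx, hy, e⟩ := exists_gen_eq X k z
  replace hx : x ∈ extendByBot (fun j => F j n d) (fun j => 2 * j) i := hx ▸ hz.1
  replace hy : y ∈ extendByBot (fun j => F j n (d - (k - 1))) (fun j => 2 * j + 1) i :=
    hy ▸ hz.2.2
  change (operad X k).Generated (lowerGen X k F i) _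
  rw [e, map_add, map_add, diff_gen_phi, zero_add]
  refine .add ?_ ?_
  · rw [diff_genX]
    obtain h0 | ⟨j, rfl, hj⟩ := (mem_extendByBot injective_two_mul).1 hx
    · rw [h0, map_zero, map_zero, map_zero]
      exact .zero
    · exact (incl_s_generated k le_rfl (hD j n d _ hj)).1
  · obtain h0 | ⟨j, rfl, hj⟩ := (mem_extendByBot injective_two_mul_add_one).1 hy
    · rw [h0, map_zero, map_zero]
      exact .zero
    · rw [← s_gen, diff_s X k D _ rfl rfl (by omega) (by omega), sub_eq_add_neg,
        FreeOperad.units_smul_eq (K := K), ← neg_smul]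
      refine .add (bracket_generated k (by omega) _ (genX_generated k (by omega) hj)) (.smul _ ?_)
      exact (incl_s_generated k (by omega) (hD j n _ _ hj)).2 _

end DkR

theorem mainTheorem10 {K : Type u} [Field K] [CharZero K] (X : SigmaModule.{u, v} K)
    (D : GradedOperad.Derivation (GradedOperad.Hom.id (FreeOperad X)) 1)
    (hR : IsQuasiFreeCofibrant X D) (k : ℤ) :
    IsQuasiFreeCofibrant (X.addDerivation k) (DkR.diff X k D) :=
  ⟨DkR.diff_diff X k D hR.1, DkR.hasSullivanGrading_diff k hR.2⟩
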